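/- Let $d\ge 3$ be a natural number, let $\langle Q,+,\cdot,\le\rangle$ be an arbitrary ordered field (axiom AxOField), let $B$ be a set (of bodies) with subsets $\mathsf{IOb}\subseteq B$ (inertial observers) and $\mathsf{Ph}\subseteq B$ (light signals), and let $\mathsf W\subseteq B\times B\times Q^d$ ($\mathsf W(m,b,\bar x)$ means that $m$ coordinatizes $b$ at $\bar x$). For $\bar x,\bar y\in Q^d$ put $\mathsf{time}(\bar x,\bar y)=x_1-y_1$, $\mathsf{space}^2(\bar x,\bar y)=(x_2-y_2)^2+\dots+(x_d-y_d)^2$ and $\mathsf{ev}_m(\bar x)=\{b\in B:\mathsf W(m,b,\bar x)\}$. Assume: - (AxPh) for every $m\in\mathsf{IOb}$ there is $c_m\in Q$, $c_m>0$, such that for all $\bar x,\bar y\in Q^d$: there is $p\in\mathsf{Ph}$ with $\mathsf W(m,p,\bar x)$ and $\mathsf W(m,p,\bar y)$ if and only if $\mathsf{space}^2(\bar x,\bar y)=c_m^2\cdot\mathsf{time}(\bar x,\bar y)^2$; - (AxEv) for all $m,k\in\mathsf{IOb}$ and $\bar x\in Q^d$ there is $\bar y\in Q^d$ with $\mathsf{ev}_m(\bar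 x)=\mathsf{ev}_k(\bar y)$; - (AxSymD) for all $m,k\in\mathsf{IOb}$ and $\bar x,\bar y,\bar x',\bar y'\in Q^d$ with $x_1=y_1$, $x'_1=y'_1$, $\mathsf{ev}_m(\bar x)=\mathsf{ev}_k(\bar x')$ and $\mathsf{ev}_m(\bar y)=\mathsf{ev}_k(\bar y')$ we have $\mathsf{space}^2(\bar x,\bar y)=\mathsf{space}^2(\bar x',\bar y')$; and for every $m\in\mathsf{IOb}$ there is $p\in\mathsf{Ph}$ with $\mathsf W(m,p,\langle 0,\dots,0\rangle)$ and $\mathsf W(m,p,\langle 1,1,0,\dots,0\rangle)$. Then for all $m,k\in\mathsf{IOb}$ the worldview transformation, i.e. the binary relation $$\mathsf w_{mk}(\bar x,\bar y)\iff \mathsf{ev}_m(\bar x)=\mathsf{ev}_k(\bar y)\neq\emptyset$$ on $Q^d$, is a Poincaré transformation: it is the graph of an affine bijection $P:Q^d\to Q^d$ such that $\mathsf{time}(\bar x,\bar y)^2-\mathsf{space}^2(\bar x,\bar y)=\mathsf{time}(P(\bar x),P(\bar y))^2-\mathsf{space}^2(P(\bar x),P(\bar y))$ for all $\bar x,\bar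 y\in Q^d$. -/

import Mathlib

namespace SpecRel

/-- Coordinate points: `d`-tuples of quantities. The coordinate with index `0` is the time
coordinate, written `x₁` in 1-based indexing; all the other ones are the spatial coordinates. -/
abbrev Coord (d : ℕ) (Q : Type*) : Type _ := Fin d → Q

/-- The body part and the worldview relation of a model of the two-sorted language
`{B, Q ; Ob, IOb, Ph, +, ·, ≤, W}` in spacetime dimension `d`. The symbols `+`, `·`, `≤` on the
sort `Q` are given by the algebraic structure carried by the type `Q`. -/
structure Model (d : ℕ) (B Q : Type*) where
  /-- the observers -/
  Ob : Set B
  /-- the inertial observers -/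
  IOb : Set B
  /-- the light signals -/
  Ph : Set B
  /-- `W m b x`: body `m` coordinatizes body `b` at the coordinate point `x` -/
  W : B → B → Coord d Q → Prop

section Coordinates

variable {d : ℕ} [NeZero d] {Q : Type*} [Field Q]

/-- The time difference `x₁ - y₁`. -/
def time (x y : Coord d Q) : Q := x 0 - y 0

/-- The squared spatial distance `(x₂ - y₂)² + ⋯ + (x_d - y_d)²`. -/
def space2 (x y : Coord d Q) : Q := ∑ i ∈ Finset.univ.erase (0 : Fin d), (x i - y i) ^ 2

/-- The coordinate point `⟨1, 1, 0, …, 0⟩`. -/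
def lightPoint (d : ℕ) (Q : Type*) [Field Q] : Coord d Q :=
  fun i => if (i : ℕ) ≤ 1 then 1 else 0

/-- A map `P : Q^d → Q^d` is a Poincaré transformation iff it is an affine bijection that
preserves `time² - space²`. -/
structure IsPoincare (P : Coord d Q → Coord d Q) : Prop where
  affine : ∃ f : Coord d Q →ᵃ[Q] Coord d Q, ⇑f = P
  bijective : Function.Bijective P
  interval : ∀ x y : Coord d Q,
    time x y ^ 2 - space2 x y = time (P x) (P y) ^ 2 - space2 (P x) (P y)

/-- A binary relation on `Q^d` is a Poincaré transformation iff it is (the graph of) a map that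
is a Poincaré transformation. -/
def IsPoincareRel (R : Coord d Q → Coord d Q → Prop) : Prop :=
  ∃ P : Coord d Q → Coord d Q, IsPoincare P ∧ ∀ x y, R x y ↔ P x = y

end Coordinates

namespace Model

variable {d : ℕ} {B Q : Type*}

/-- The event occurring for `m` at `x`: the set of bodies that `m` coordinatizes at `x`. -/
def ev (M : Model d B Q) (m : B) (x : Coord d Q) : Set B := {b | M.W m b x}

/-- The worldview transformation between `m` and `k`, a binary relation: it relates the
coordinate points at which `m` and `k` coordinatize the same nonempty event. -/
def worldview (M : Model d B Q) (m k : B) (x y : Coord d Q) : Prop :=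
  M.ev m x = M.ev k y ∧ (M.ev m x).Nonempty

/-- All inertial observers coordinatize the same set of events. -/
def AxEv (M : Model d B Q) : Prop :=
  ∀ m ∈ M.IOb, ∀ k ∈ M.IOb, ∀ x : Coord d Q, ∃ y : Coord d Q, M.ev m x = M.ev k y

variable [NeZero d] [Field Q]

/-- For any inertial observer, the speed of light is the same positive quantity everywhere and
in every direction, and a light signal can be sent out in any direction everywhere. -/
def AxPh [LinearOrder Q] (M : Model d B Q) : Prop :=
  ∀ m ∈ M.IOb, ∃ c : Q, 0 < c ∧ ∀ x y : Coord d Q,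
    (∃ p ∈ M.Ph, M.W m p x ∧ M.W m p y) ↔ space2 x y = c ^ 2 * time x y ^ 2

/-- Any two inertial observers agree as to the spatial distance between two events that are
simultaneous for both of them; and the speed of light is `1` for all inertial observers, in the
form that a light signal passes through `⟨0, …, 0⟩` and `⟨1, 1, 0, …, 0⟩`. -/
def AxSymD (M : Model d B Q) : Prop :=
  (∀ m ∈ M.IOb, ∀ k ∈ M.IOb, ∀ x y x' y' : Coord d Q,
    x 0 = y 0 → x' 0 = y' 0 → M.ev m x = M.ev k x' → M.ev m y = M.ev k y' →
      space2 x y = space2 x' y') ∧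
  (∀ m ∈ M.IOb, ∃ p ∈ M.Ph, M.W m p 0 ∧ M.W m p (lightPoint d Q))

end Model

end SpecRel

/-! The light signal through `0` and `lightPoint` forces `c² = 1`, so lightlike relatedness is
nullity of the Minkowski form, and an event determines its light cone, hence its point
(`ev_injective`). The worldview relation is thus a bijection preserving nullity both ways, and an
Alexandrov–Zeeman argument over an ordered field applies. Light lines and their tangent hyperplanes
are definable from nullity, so parallel light lines stay parallel and null parallelograms are
preserved; as null vectors span, the map is affine up to a field map `σ` (`map_add`,
`exists_semilinear`). Nullity alone excludes neither a nontrivial `σ` nor a dilation. Since `d ≥ 3`,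
some nonzero `v` is simultaneous with the origin for both observers (`exists_simultaneous`); the
symmetry axiom along `v` gives `σ = id` and scale factor `1` (`isLorentz`). -/

namespace SpecRel

open Finset

variable {d : ℕ} [NeZero d] {Q : Type*} [Field Q]

/-! ### Minkowski form, null vectors and parallel light lines. -/

section

/-- The Minkowski bilinear form `x₀ y₀ - ∑ᵢ xᵢ yᵢ`. -/
def mink (d : ℕ) [NeZero d] (Q : Type*) [Field Q] : LinearMap.BilinForm Q (Coord d Q) :=
  LinearMap.mk₂ Q (fun x y => x 0 * y 0 - ∑ i ∈ univ.erase (0 : Fin d), x i * y i)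
    (fun x x' y => by
      simp only [Pi.add_apply, add_mul, sum_add_distrib]; ring)
    (fun c x y => by
      simp only [Pi.smul_apply, smul_eq_mul, mul_assoc, ← mul_sum]; ring)
    (fun x y y' => by
      simp only [Pi.add_apply, mul_add, sum_add_distrib]; ring)
    (fun c x y => by
      simp only [Pi.smul_apply, smul_eq_mul, mul_left_comm _ c, ← mul_sum]; ring)

theorem mink_apply (x y : Coord d Q) :
    mink d Q x y = x 0 * y 0 - ∑ i ∈ univ.erase (0 : Fin d), x i * y i := rfl

theorem mink_comm (x y : Coord d Q) : mink d Q x y = mink d Q y x := by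
  simp only [mink_apply, mul_comm]

theorem mink_sub_self (x y : Coord d Q) :
    mink d Q (x - y) (x - y) = time x y ^ 2 - space2 x y := by
  simp only [mink_apply, time, space2, Pi.sub_apply, sq]

theorem mink_sub_sub (v w : Coord d Q) :
    mink d Q (v - w) (v - w) = mink d Q v v - 2 * mink d Q v w + mink d Q w w := by
  simp only [map_sub, LinearMap.sub_apply, mink_comm w v]
  ring

theorem mink_single_single (i j : Fin d) :
    mink d Q (Pi.single i 1) (Pi.single j 1) =
      if i = j then (if i = 0 then 1 else -1) else 0 := by
  have h : ∀ k : Fin d, (Pi.single i (1 : Q) : Coord d Q) k * (Pi.single j (1 : Q) : Coord d Q) k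
      = if k = i then (if i = j then 1 else 0) else 0 := by
    intro k
    simp only [Pi.single_apply]
    split_ifs <;> simp_all
  rw [mink_apply, h]
  simp only [h]
  by_cases hi : i = 0 <;> by_cases hij : i = j <;> simp [hi, hij, eq_comm]
  aesop

section Null

variable [LinearOrder Q] [IsStrictOrderedRing Q]

theorem time_ne_zero_of_null {u : Coord d Q} (hu : mink d Q u u = 0) (h0 : u ≠ 0) : u 0 ≠ 0 := by
  intro h
  apply h0
  rw [mink_apply, h, mul_zero, zero_sub, neg_eq_zero,
    sum_eq_zero_iff_of_nonneg (fun i _ => mul_self_nonneg _)] at hu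
  funext i
  by_cases hi : i = 0
  · rw [hi, h]; rfl
  · exact mul_self_eq_zero.1 (hu i (by simp [hi]))

theorem sum_sq_le_of_null {u : Coord d Q} (hu : mink d Q u u = 0) {i j : Fin d} (hij : i ≠ j)
    (hi : i ≠ 0) (hj : j ≠ 0) : u i * u i + u j * u j ≤ u 0 * u 0 := by
  rw [mink_apply, sub_eq_zero] at hu
  rw [hu, ← sum_pair (f := fun i => u i * u i) hij]
  apply sum_le_sum_of_subset_of_nonneg
  · intro k; simp; rintro (rfl | rfl) <;> assumption
  · intro k _ _; exact mul_self_nonneg _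

/-- Orthogonal null vectors are proportional. -/
theorem exists_smul_of_null_orthogonal {u w : Coord d Q} (hu : mink d Q u u = 0) (h0 : u ≠ 0)
    (hw : mink d Q w w = 0) (huw : mink d Q u w = 0) : ∃ c : Q, w = c • u := by
  have ht := time_ne_zero_of_null hu h0
  -- This combination is null and has time component zero, so it vanishes.
  have hn : mink d Q (u 0 • w - w 0 • u) (u 0 • w - w 0 • u) = 0 := by
    simp [hu, hw, huw, mink_comm w u]
  have hz : u 0 • w - w 0 • u = 0 := by
    by_contra hne
    apply time_ne_zero_of_null hn hne
    simp [mul_comm]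
  refine ⟨(u 0)⁻¹ * w 0, ?_⟩
  rw [mul_smul, ← sub_eq_zero.1 hz, smul_smul, inv_mul_cancel₀ ht, one_smul]

/-- Describes a light line by nullity relative to two of its points, a condition that light
bijections respect. -/
theorem exists_eq_add_smul_iff {u z : Coord d Q} (x : Coord d Q) (hu : mink d Q u u = 0)
    (h0 : u ≠ 0) : (∃ s : Q, z = x + s • u) ↔
      mink d Q (z - x) (z - x) = 0 ∧ mink d Q (z - (x + u)) (z - (x + u)) = 0 := by
  constructor
  · rintro ⟨s, rfl⟩
    have : x + s • u - (x + u) = (s - 1) • u := by module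
    rw [this]
    simp [hu]
  · rintro ⟨h1, h2⟩
    have : z - (x + u) = (z - x) - u := by abel
    rw [this, mink_sub_sub, h1, hu] at h2
    have h3 : mink d Q u (z - x) = 0 := by rw [mink_comm]; linarith
    obtain ⟨c, hc⟩ := exists_smul_of_null_orthogonal hu h0 h1 h3
    exact ⟨c, by rw [← hc]; abel⟩

/-- A point lies in the hyperplane tangent to the light cone along a light line iff it is on the
line or no light signal connects it to the line. -/
theorem mink_sub_eq_zero_iff {u z : Coord d Q} (x : Coord d Q) (hu : mink d Q u u = 0)
    (h0 : u ≠ 0) : mink d Q (z - x) u = 0 ↔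
      (∃ s : Q, z = x + s • u) ∨
        ∀ y, (∃ s : Q, y = x + s • u) → mink d Q (z - y) (z - y) ≠ 0 := by
  -- Since `u` is null, the interval from `z` is affine in `s`; it has a root whenever its slope is
  -- nonzero.
  have key : ∀ s : Q, mink d Q (z - (x + s • u)) (z - (x + s • u)) =
      mink d Q (z - x) (z - x) - 2 * s * mink d Q (z - x) u := by
    intro s
    have : z - (x + s • u) = (z - x) - s • u := by abel
    rw [this, mink_sub_sub]
    simp only [map_smul, LinearMap.smul_apply, hu, smul_eq_mul]
    ring
  constructor
  · intro h
    by_cases hz : mink d Q (z - x) (z - x) = 0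
    · left
      obtain ⟨c, hc⟩ := exists_smul_of_null_orthogonal hu h0 hz (by rw [mink_comm, h])
      exact ⟨c, by rw [← hc]; abel⟩
    · right
      rintro y ⟨s, rfl⟩
      rwa [key, h, mul_zero, sub_zero]
  · rintro (⟨s, rfl⟩ | h)
    · simp [hu]
    · by_contra hne
      refine h _ ⟨mink d Q (z - x) (z - x) / (2 * mink d Q (z - x) u), rfl⟩ ?_
      rw [key]
      field_simp
      ring

end Null

/-- A bijection of `Q^d` that preserves lightlike relatedness in both directions. -/
structure IsLightBijection (P : Coord d Q → Coord d Q) : Prop where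
  bijective : Function.Bijective P
  null_iff : ∀ x y, mink d Q (P x - P y) (P x - P y) = 0 ↔ mink d Q (x - y) (x - y) = 0

namespace IsLightBijection

variable {P : Coord d Q → Coord d Q} (hP : IsLightBijection P)
include hP

theorem null_map {u : Coord d Q} (x : Coord d Q) (hu : mink d Q u u = 0) :
    mink d Q (P (x + u) - P x) (P (x + u) - P x) = 0 := by
  rw [hP.null_iff, add_sub_cancel_left, hu]

theorem map_sub_ne_zero {u : Coord d Q} (x : Coord d Q) (h0 : u ≠ 0) : P (x + u) - P x ≠ 0 := by
  intro h
  apply h0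
  have := hP.bijective.1 (sub_eq_zero.1 h)
  simpa using this

variable [LinearOrder Q] [IsStrictOrderedRing Q]

theorem line_iff {u : Coord d Q} (x z : Coord d Q) (hu : mink d Q u u = 0) (h0 : u ≠ 0) :
    (∃ s : Q, P z = P x + s • (P (x + u) - P x)) ↔ ∃ s : Q, z = x + s • u := by
  rw [exists_eq_add_smul_iff x hu h0,
    exists_eq_add_smul_iff (P x) (hP.null_map x hu) (hP.map_sub_ne_zero x h0),
    add_sub_cancel, hP.null_iff, hP.null_iff]

theorem tangent_iff {u : Coord d Q} (x z : Coord d Q) (hu : mink d Q u u = 0) (h0 : u ≠ 0) :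
    mink d Q (P z - P x) (P (x + u) - P x) = 0 ↔ mink d Q (z - x) u = 0 := by
  rw [mink_sub_eq_zero_iff x hu h0,
    mink_sub_eq_zero_iff (P x) (hP.null_map x hu) (hP.map_sub_ne_zero x h0),
    hP.line_iff x z hu h0, hP.bijective.2.forall]
  simp only [hP.line_iff x _ hu h0, ne_eq, hP.null_iff]

/-- Parallel light lines have parallel images. -/
theorem mink_map_parallel {u : Coord d Q} (x y : Coord d Q) (hu : mink d Q u u = 0)
    (h0 : u ≠ 0) : mink d Q (P (x + u) - P x) (P (y + u) - P y) = 0 := by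
  by_contra hne
  have hx := hP.tangent_iff x (u := u) (hu := hu) (h0 := h0)
  have hy := hP.tangent_iff y (u := u) (hu := hu) (h0 := h0)
  have hnx := hP.null_map x hu
  set u₁ := P (x + u) - P x
  set u₂ := P (y + u) - P y
  -- `P z` is where the first image line meets the tangent hyperplane of the second; `P z'` is on
  -- the first line but off that hyperplane. The original tangent hyperplanes are parallel and share
  -- `z`, hence coincide: a contradiction.
  obtain ⟨z, hz⟩ := hP.bijective.2 (P x + (mink d Q (P y - P x) u₂ / mink d Q u₁ u₂) • u₁)
  obtain ⟨z', hz'⟩ := hP.bijective.2 (P z + u₁)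
  have h1 : mink d Q (z - x) u = 0 := by
    rw [← hx, hz]; simp [hnx]
  have h2 : mink d Q (z - y) u = 0 := by
    rw [← hy, hz]
    simp only [map_sub, map_add, map_smul, LinearMap.sub_apply, LinearMap.add_apply,
      LinearMap.smul_apply, smul_eq_mul]
    field_simp
    ring
  have h3 : mink d Q (z' - x) u = 0 := by
    rw [← hx, hz', hz]; simp [hnx]
  have h4 : mink d Q (z' - y) u ≠ 0 := by
    rw [Ne, ← hy, hz', add_sub_right_comm, map_add, LinearMap.add_apply, (hy z).2 h2, zero_add]
    exact hne
  apply h4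
  have : z' - y = (z' - x) - (z - x) + (z - y) := by abel
  rw [this]
  simp only [map_add, LinearMap.add_apply, h2]
  simp only [map_sub (mink d Q) (z' - x), LinearMap.sub_apply, h3, h1]
  ring

/-- Opposite sides of the image are proportional, and closing the quadrilateral gives `(c - 1) • u'
= (e - 1) • w'`. Pairing with the null `w'` leaves `c = 1`. -/
theorem parallelogram {u w : Coord d Q} (x : Coord d Q) (hu : mink d Q u u = 0)
    (hw : mink d Q w w = 0) (huw : mink d Q u w ≠ 0) :
    P (x + w + u) - P (x + w) = P (x + u) - P x := by
  have hu0 : u ≠ 0 := by rintro rfl; simp at huw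
  have hw0 : w ≠ 0 := by rintro rfl; simp at huw
  have hne : mink d Q (P (x + w) - P x) (P (x + u) - P x) ≠ 0 := by
    rw [Ne, hP.tangent_iff x _ hu hu0, add_sub_cancel_left, mink_comm]
    exact huw
  obtain ⟨c, hc⟩ := exists_smul_of_null_orthogonal (hP.null_map x hu) (hP.map_sub_ne_zero x hu0)
    (hP.null_map (x + w) hu) (hP.mink_map_parallel x (x + w) hu hu0)
  obtain ⟨e, he⟩ := exists_smul_of_null_orthogonal (hP.null_map x hw) (hP.map_sub_ne_zero x hw0)
    (hP.null_map (x + u) hw) (hP.mink_map_parallel x (x + u) hw hw0)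
  have hnw := hP.null_map x hw
  rw [add_right_comm] at he
  set u' := P (x + u) - P x
  set w' := P (x + w) - P x
  have h : (c - 1) • u' = (e - 1) • w' := by
    rw [sub_smul, sub_smul, ← hc, ← he]
    simp only [u', w']
    module
  have h' := congrArg (mink d Q w') h
  rw [map_smul, map_smul, hnw, smul_zero, smul_eq_mul, mul_eq_zero, or_iff_left hne,
    sub_eq_zero] at h'
  rw [hc, h', one_smul]

end IsLightBijection

end

/-! ### Spanning by null vectors, and additivity. -/

section

theorem exists_two_spatial (hd : 3 ≤ d) : ∃ i j : Fin d, i ≠ 0 ∧ j ≠ 0 ∧ i ≠ j := by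
  refine ⟨⟨1, by omega⟩, ⟨2, by omega⟩, ?_, ?_, ?_⟩ <;> simp [Fin.ext_iff]

omit [NeZero d] in
theorem submodule_eq_top_of_single {N : Submodule Q (Coord d Q)}
    (h : ∀ i, (Pi.single i 1 : Coord d Q) ∈ N) : N = ⊤ := by
  rw [eq_top_iff, ← (Pi.basisFun Q (Fin d)).span_eq, Submodule.span_le]
  rintro _ ⟨i, rfl⟩
  simpa using h i

theorem mink_single_right {i : Fin d} (hi : i ≠ 0) (u : Coord d Q) :
    mink d Q u (Pi.single i 1) = -u i := by
  simp [mink_apply, Pi.single_apply, hi, hi.symm]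

theorem mink_single_zero_right (u : Coord d Q) : mink d Q u (Pi.single 0 1) = u 0 := by
  rw [mink_apply, sum_eq_zero]
  · simp
  · intro i hi
    simp [(mem_erase.1 hi).1]

/-- A null vector with time component `1` pointing in the `i`-th direction. -/
def nullSingle (i : Fin d) (s : Q) : Coord d Q := Pi.single 0 1 + s • Pi.single i 1

/-- A null vector in the plane of the `i`-th and `j`-th directions. -/
def nullPair (i j : Fin d) (s : Q) : Coord d Q :=
  -- The triple 3, 4, 5 avoids square roots, which `Q` may lack; the vector is null for `s = ±1`.
  (5 : Q) • Pi.single 0 1 + (3 : Q) • Pi.single i 1 + (4 * s) • Pi.single j 1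

theorem nullSingle_null {i : Fin d} (hi : i ≠ 0) {s : Q} (hs : s * s = 1) :
    mink d Q (nullSingle i s) (nullSingle i s) = 0 := by
  simp [nullSingle, mink_single_single, hi, hi.symm, hs]

theorem nullPair_null {i j : Fin d} (hi : i ≠ 0) (hj : j ≠ 0) (hij : i ≠ j) {s : Q}
    (hs : s * s = 1) : mink d Q (nullPair i j s) (nullPair i j s) = 0 := by
  simp [nullPair, mink_single_single, hi, hi.symm, hj, hj.symm, hij, hij.symm]
  linear_combination (-16) * hs

theorem mink_nullSingle {i : Fin d} (hi : i ≠ 0) (u : Coord d Q) (s : Q) :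
    mink d Q u (nullSingle i s) = u 0 - s * u i := by
  simp only [nullSingle, map_add, map_smul, mink_single_zero_right, mink_single_right hi,
    smul_eq_mul]
  ring

theorem mink_nullPair {i j : Fin d} (hi : i ≠ 0) (hj : j ≠ 0) (u : Coord d Q) (s : Q) :
    mink d Q u (nullPair i j s) = 5 * u 0 - 3 * u i - 4 * s * u j := by
  simp only [nullPair, map_add, map_smul, mink_single_zero_right, mink_single_right hi,
    mink_single_right hj, smul_eq_mul]
  ring

variable [LinearOrder Q] [IsStrictOrderedRing Q]

/-- The null vectors that are not parallel to a given null vector span the whole space. -/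
theorem eq_top_of_null_mem (hd : 3 ≤ d) {u : Coord d Q} (hu : mink d Q u u = 0) (h0 : u ≠ 0)
    {N : Submodule Q (Coord d Q)}
    (hN : ∀ w, mink d Q w w = 0 → mink d Q u w ≠ 0 → w ∈ N) : N = ⊤ := by
  have ht := time_ne_zero_of_null hu h0
  have ht2 : 0 < u 0 * u 0 := mul_self_pos.2 ht
  -- Two spatial coordinates of square `u 0 * u 0` would exceed the null bound; for this `j`,
  -- neither `nullSingle j (±1)` is orthogonal to `u`.
  obtain ⟨j, hj, hju⟩ : ∃ j : Fin d, j ≠ 0 ∧ u j * u j ≠ u 0 * u 0 := by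
    obtain ⟨i, j, hi, hj, hij⟩ := exists_two_spatial hd
    by_contra! h
    have := sum_sq_le_of_null hu hij hi hj
    rw [h i hi, h j hj] at this
    linarith
  have hp : nullSingle j (1 : Q) ∈ N := by
    refine hN _ (nullSingle_null hj (by ring)) ?_
    rw [mink_nullSingle hj]
    intro h
    apply hju
    linear_combination (-(u 0) - u j) * h
  have hm : nullSingle j (-1 : Q) ∈ N := by
    refine hN _ (nullSingle_null hj (by ring)) ?_
    rw [mink_nullSingle hj]
    intro h
    apply hju
    linear_combination (-(u 0) + u j) * h
  have he0 : (Pi.single 0 1 : Coord d Q) ∈ N := by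
    have := N.smul_mem (2⁻¹ : Q) (N.add_mem hp hm)
    convert this using 1
    simp only [nullSingle]
    module
  have hej : (Pi.single j 1 : Coord d Q) ∈ N := by
    have := N.sub_mem hp he0
    simpa [nullSingle] using this
  apply submodule_eq_top_of_single
  intro i
  by_cases hi : i = 0
  · rwa [hi]
  by_cases hij : i = j
  · rwa [hij]
  -- Orthogonality for both signs would force `u i = 5/3 * u 0`, too large for a null vector.
  have : ∃ s : Q, s * s = 1 ∧ mink d Q u (nullPair i j s) ≠ 0 := by
    by_contra! h
    have h1 := h 1 (by ring)
    have h2 := h (-1) (by ring)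
    rw [mink_nullPair hi hj] at h1 h2
    have h3 : u i = 5 / 3 * u 0 := by linarith
    have := sum_sq_le_of_null hu hij hi hj
    rw [h3] at this
    nlinarith [mul_self_nonneg (u j)]
  obtain ⟨s, hs, hne⟩ := this
  have hmem := hN _ (nullPair_null hi hj hij hs) hne
  have := N.smul_mem (3⁻¹ : Q)
    (N.sub_mem (N.sub_mem hmem (N.smul_mem (5 : Q) he0)) (N.smul_mem (4 * s) hej))
  convert this using 1
  simp only [nullPair]
  module

/-- A quadratic form vanishing on all null vectors is a multiple of the Minkowski form. -/
theorem eq_smul_mink_of_null {b : LinearMap.BilinForm Q (Coord d Q)}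
    (hb : ∀ x y, b x y = b y x) (hnull : ∀ u, mink d Q u u = 0 → b u u = 0) :
    b = b (Pi.single 0 1) (Pi.single 0 1) • mink d Q := by
  have h1 : ∀ i : Fin d, i ≠ 0 → b (Pi.single 0 1) (Pi.single i 1) = 0 ∧
      b (Pi.single i 1) (Pi.single i 1) = - b (Pi.single 0 1) (Pi.single 0 1) := by
    intro i hi
    have hp := hnull _ (nullSingle_null hi (s := (1 : Q)) (by ring))
    have hm := hnull _ (nullSingle_null hi (s := (-1 : Q)) (by ring))
    simp only [nullSingle, map_add, map_smul, LinearMap.add_apply, LinearMap.smul_apply,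
      smul_eq_mul, hb (Pi.single i 1) (Pi.single 0 1)] at hp hm
    constructor <;> linarith
  have h2 : ∀ i j : Fin d, i ≠ 0 → j ≠ 0 → i ≠ j → b (Pi.single i 1) (Pi.single j 1) = 0 := by
    intro i j hi hj hij
    have hp := hnull _ (nullPair_null hi hj hij (s := (1 : Q)) (by ring))
    simp only [nullPair, map_add, map_smul, LinearMap.add_apply, LinearMap.smul_apply,
      smul_eq_mul, hb (Pi.single i 1) (Pi.single 0 1), hb (Pi.single j 1) (Pi.single 0 1),
      hb (Pi.single j 1) (Pi.single i 1), (h1 i hi).1, (h1 i hi).2, (h1 j hj).1, (h1 j hj).2]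
      at hp
    linarith
  refine LinearMap.BilinForm.ext_basis (Pi.basisFun Q (Fin d)) fun i j => ?_
  simp only [Pi.basisFun_apply, LinearMap.smul_apply, mink_single_single, smul_eq_mul]
  by_cases hi : i = 0 <;> by_cases hj : j = 0
  · simp [hi, hj]
  · simp [hi, Ne.symm hj, (h1 j hj).1]
  · simp [hi, hj, hb _ (Pi.single 0 1), (h1 i hi).1]
  · by_cases hij : i = j
    · subst hij
      simp [hi, (h1 i hi).2]
    · simp [hij, h2 i j hi hj hij]

namespace IsLightBijection

variable {P : Coord d Q → Coord d Q} (hP : IsLightBijection P)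
include hP

theorem map_add_null (hd : 3 ≤ d) {u : Coord d Q} (x : Coord d Q) (hu : mink d Q u u = 0) :
    P (x + u) = P x + (P u - P 0) := by
  by_cases h0 : u = 0
  · simp [h0]
  let N : Submodule Q (Coord d Q) :=
    -- Quantifying over `s` gives closure under scalars before `P` is known to respect them.
    { carrier := {w | ∀ (s : Q) x, P (x + s • w + u) - P (x + s • w) = P (x + u) - P x}
      add_mem' := by
        intro v w hv hw s x
        rw [smul_add, ← add_assoc, hw, hv]
      zero_mem' := by simp
      smul_mem' := by
        intro c w hw s x
        rw [smul_smul, hw] }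
  have hN : N = ⊤ := by
    refine eq_top_of_null_mem hd hu h0 fun w hw huw s x => ?_
    by_cases hs : s = 0
    · simp [hs]
    · exact hP.parallelogram x hu (by simp [hw]) (by simp [hs, huw])
  have hx : x ∈ N := hN ▸ Submodule.mem_top
  have := hx 1 0
  simp only [one_smul, zero_add] at this
  rw [← this]
  abel

theorem map_add (hd : 3 ≤ d) (x y : Coord d Q) : P (x + y) = P x + (P y - P 0) := by
  let N : Submodule Q (Coord d Q) :=
    { carrier := {w | ∀ (s : Q) x, P (x + s • w) = P x + (P (s • w) - P 0)}
      add_mem' := by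
        intro v w hv hw s x
        rw [smul_add, ← add_assoc, hw, hv, hw (x := s • v)]
        abel
      zero_mem' := by simp
      smul_mem' := by
        intro c w hw s x
        rw [smul_smul, hw] }
  have hN : N = ⊤ := by
    obtain ⟨i, -, hi, -⟩ := exists_two_spatial hd
    have hn := nullSingle_null hi (s := (1 : Q)) (by ring)
    refine eq_top_of_null_mem hd hn ?_ fun w hw _ s x =>
      hP.map_add_null hd x (by simp [hw])
    intro h
    simpa [nullSingle, hi.symm] using congrFun h 0
  have hy : y ∈ N := hN ▸ Submodule.mem_top
  simpa using hy 1 x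

end IsLightBijection

/-- Three null vectors no two of which are orthogonal are linearly independent. -/
theorem coeff_eq_of_null {a b c : Coord d Q} (ha : mink d Q a a = 0) (hb : mink d Q b b = 0)
    (hc : mink d Q c c = 0) (hab : mink d Q a b ≠ 0) (hac : mink d Q a c ≠ 0)
    (hbc : mink d Q b c ≠ 0) {α β γ : Q} (h : α • a + β • b = γ • c) :
    α = 0 ∧ β = 0 ∧ γ = 0 := by
  have h1 := congrArg (mink d Q a) h
  have h2 := congrArg (mink d Q b) h
  have h3 := congrArg (mink d Q c) h
  simp only [map_add, map_smul, ha, hb, hc, smul_eq_mul, mul_zero, zero_add, add_zero,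
    mink_comm b a, mink_comm c a, mink_comm c b] at h1 h2 h3
  have hα : α = 0 := by
    have : α * (2 * mink d Q a c * mink d Q a b) = 0 := by
      linear_combination mink d Q a b * h3 + mink d Q a c * h2 - mink d Q b c * h1
    simpa [hab, hac] using this
  subst hα
  have hγ : γ = 0 := by simpa [hbc] using h2.symm
  subst hγ
  simpa [hab] using h1

end

/-! ### Semilinearity and the Lorentz property. -/

section

theorem nullSingle_ne_zero {i : Fin d} (hi : i ≠ 0) (s : Q) : nullSingle i s ≠ 0 := by
  intro h
  simpa [nullSingle, hi.symm] using congrFun h 0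

namespace IsLightBijection

variable {A : Coord d Q → Coord d Q}

theorem sub_const (hA : IsLightBijection A) (v : Coord d Q) :
    IsLightBijection fun x => A x - v where
  bijective := (Equiv.subRight v).bijective.comp hA.bijective
  null_iff x y := by rw [sub_sub_sub_cancel_right, hA.null_iff]

variable (hA : IsLightBijection A) (h0 : A 0 = 0)
include hA h0

theorem map_null {u : Coord d Q} (hu : mink d Q u u = 0) : mink d Q (A u) (A u) = 0 := by
  simpa [h0] using hA.null_map 0 hu

theorem map_ne_zero {u : Coord d Q} (hu : u ≠ 0) : A u ≠ 0 := by
  simpa [h0] using hA.map_sub_ne_zero 0 hu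

variable [LinearOrder Q] [IsStrictOrderedRing Q]

theorem mink_map_ne_zero {u w : Coord d Q} (hu : mink d Q u u = 0) (huw : mink d Q w u ≠ 0) :
    mink d Q (A w) (A u) ≠ 0 := by
  have hu0 : u ≠ 0 := by rintro rfl; simp at huw
  have := hA.tangent_iff 0 w hu hu0
  simp only [h0, zero_add, sub_zero] at this
  rwa [Ne, this]

theorem exists_map_smul_null {u : Coord d Q} (hu : mink d Q u u = 0) (hu0 : u ≠ 0) :
    ∃ σ : Q → Q, Function.Surjective σ ∧ ∀ c, A (c • u) = σ c • A u := by
  have hline := fun z => hA.line_iff 0 z hu hu0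
  simp only [h0, zero_add, sub_zero] at hline
  have : ∀ c : Q, ∃ t : Q, A (c • u) = t • A u := fun c => (hline _).2 ⟨c, rfl⟩
  choose σ hσ using this
  refine ⟨σ, fun t => ?_, hσ⟩
  obtain ⟨z, hz⟩ := hA.bijective.2 (t • A u)
  obtain ⟨c, rfl⟩ := (hline z).1 ⟨t, hz⟩
  refine ⟨c, smul_left_injective Q (hA.map_ne_zero h0 hu0) ?_⟩
  simp only [← hσ, hz]

theorem map_add_of_map_zero (hd : 3 ≤ d) (x y : Coord d Q) : A (x + y) = A x + A y := by
  rw [hA.map_add hd, h0, sub_zero]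

/-- Two null directions are rescaled in the same way if there is a third one in general position
with respect to them. -/
theorem smul_factor_eq (hd : 3 ≤ d) {σ : Coord d Q → Q → Q}
    (hσ : ∀ u, mink d Q u u = 0 → ∀ c, A (c • u) = σ u c • A u) {u w n : Coord d Q}
    (hu : mink d Q u u = 0) (hw : mink d Q w w = 0) (hn : mink d Q n n = 0)
    (huw : mink d Q u w ≠ 0) (hun : mink d Q u n ≠ 0) (hwn : mink d Q w n ≠ 0)
    (hne : mink d Q u n + mink d Q w n ≠ 0) : σ u = σ w := by
  have hadd := hA.map_add_of_map_zero h0 hd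
  -- This `t` makes `v = u + w - t • n` null.
  obtain ⟨t, ht⟩ : ∃ t, t = mink d Q u w / (mink d Q u n + mink d Q w n) := ⟨_, rfl⟩
  have ht0 : t ≠ 0 := ht ▸ div_ne_zero huw hne
  have htn : mink d Q (t • n) (t • n) = 0 := by simp [hn]
  obtain ⟨v, hv⟩ : ∃ v, v = u + w - t • n := ⟨_, rfl⟩
  have hvn : mink d Q v v = 0 := by
    rw [hv, mink_sub_sub, htn]
    simp only [_root_.map_add, LinearMap.add_apply, hu, hw, mink_comm w u, map_smul, smul_eq_mul, ht]
    field_simp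
    ring
  have hsum : u + w = t • n + v := by rw [hv]; abel
  funext c
  have e1 := hadd u w
  -- Scaling `u + w = t • n + v` by `c` and eliminating `A v` leaves a relation among three
  -- independent image vectors, so all the factors agree at `c`.
  have e2 := hadd (c • u) (c • w)
  rw [hsum, hadd] at e1
  rw [← smul_add, hsum, smul_add, hadd, hσ u hu, hσ w hw, hσ _ htn, hσ v hvn,
    eq_sub_of_add_eq' e1, ← sub_eq_zero] at e2
  obtain ⟨k1, k2, -⟩ := coeff_eq_of_null (α := σ u c - σ v c) (β := σ w c - σ v c)
    (γ := σ (t • n) c - σ v c) (hA.map_null h0 hu) (hA.map_null h0 hw) (hA.map_null h0 htn)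
    (hA.mink_map_ne_zero h0 hw huw) (hA.mink_map_ne_zero h0 htn (by simp [ht0, hun]))
    (hA.mink_map_ne_zero h0 htn (by simp [ht0, hwn])) (by
      rw [← sub_eq_zero, ← neg_eq_zero, ← e2]
      module)
  linear_combination k1 - k2

/-- A light-preserving bijection fixing the origin is semilinear. -/
theorem exists_semilinear (hd : 3 ≤ d) :
    ∃ σ : Q → Q, Function.Surjective σ ∧ ∀ c x, A (c • x) = σ c • A x := by
  have hadd := hA.map_add_of_map_zero h0 hd
  have hneg : ∀ x, A (-x) = -A x := fun x =>
    eq_neg_of_add_eq_zero_left (by rw [← hadd, neg_add_cancel, h0])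
  have : ∀ u : Coord d Q, ∃ σ : Q → Q, mink d Q u u = 0 →
      (u ≠ 0 → Function.Surjective σ) ∧ ∀ c, A (c • u) = σ c • A u := by
    intro u
    by_cases hu0 : u = 0
    · exact ⟨id, fun _ => ⟨fun h => (h hu0).elim, by simp [hu0, h0]⟩⟩
    by_cases hu : mink d Q u u = 0
    · obtain ⟨σ, h1, h2⟩ := hA.exists_map_smul_null h0 hu hu0
      exact ⟨σ, fun _ => ⟨fun _ => h1, h2⟩⟩
    · exact ⟨id, fun h => (hu h).elim⟩
  choose σ hσ using this
  have hσ' := fun u hu => (hσ u hu).2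
  obtain ⟨i, j, hi, hj, hij⟩ := exists_two_spatial hd
  have hP : ∀ k : Fin d, k ≠ 0 → mink d Q (nullSingle k 1) (nullSingle k 1) = 0 :=
    fun k hk => nullSingle_null hk (by ring)
  have hM : ∀ k : Fin d, k ≠ 0 → mink d Q (nullSingle k (-1)) (nullSingle k (-1)) = 0 :=
    fun k hk => nullSingle_null hk (by ring)
  have hPM : ∀ k : Fin d, k ≠ 0 → mink d Q (nullSingle k 1) (nullSingle k (-1)) = 2 := by
    intro k hk
    rw [mink_nullSingle hk]
    simp [nullSingle, hk, hk.symm]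
    norm_num
  have hdiff : ∀ k l : Fin d, k ≠ 0 → l ≠ 0 → k ≠ l → ∀ s t : Q,
      mink d Q (nullSingle k s) (nullSingle l t) = 1 := by
    intro k l hk hl hkl s t
    rw [mink_nullSingle hl]
    simp [nullSingle, hk.symm, hl, hkl.symm]
  -- With `nullSingle l 1` as third direction the pairings sum to `1 + b`, hence the exclusion of `b
  -- = -1`.
  have hpm : ∀ k l : Fin d, k ≠ 0 → l ≠ 0 → k ≠ l → ∀ b : Q, b ≠ 0 → b ≠ -1 →
      σ (nullSingle k 1) = σ (b • nullSingle k (-1)) := by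
    intro k l hk hl hkl b hb hb1
    refine hA.smul_factor_eq h0 hd hσ' (hP k hk) (by simp [hM k hk]) (hP l hl) ?_ ?_ ?_ ?_
    · simp [hPM k hk, hb]
    · simp [hdiff k l hk hl hkl]
    · simp [hdiff k l hk hl hkl, hb]
    · simp only [hdiff k l hk hl hkl, map_smul, LinearMap.smul_apply, smul_eq_mul, mul_one]
      exact fun h => hb1 (by linear_combination h)
  have hpm1 : ∀ k l : Fin d, k ≠ 0 → l ≠ 0 → k ≠ l →
      σ (nullSingle k 1) = σ (nullSingle k (-1)) := by
    intro k l hk hl hkl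
    rw [hpm k l hk hl hkl 1 one_ne_zero (by norm_num), one_smul]
  have hone : ∀ k ≠ 0, σ (nullSingle k 1) = σ (nullSingle i 1) ∧
      σ (nullSingle k (-1)) = σ (nullSingle i 1) := by
    intro k hk
    by_cases hki : k = i
    · subst hki
      exact ⟨rfl, (hpm1 k j hk hj hij).symm⟩
    · have h : σ (nullSingle k 1) = σ (nullSingle i 1) := by
        refine hA.smul_factor_eq h0 hd hσ' (hP k hk) (hP i hi) (hM i hi) ?_ ?_ ?_ ?_
        · simp [hdiff k i hk hi hki]
        · simp [hdiff k i hk hi hki]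
        · simp [hPM i hi]
        · rw [hdiff k i hk hi hki, hPM i hi]
          norm_num
      exact ⟨h, (hpm1 k i hk hi hki).symm.trans h⟩
  -- For nonzero `b`, `b • nullSingle i (-1)` has the same factor as its unscaled version; `b = -1`
  -- follows from additivity.
  have hmul : ∀ a b, σ (nullSingle i 1) (a * b) =
      σ (nullSingle i 1) a * σ (nullSingle i 1) b := by
    intro a b
    have hscale : ∀ c, A (c • nullSingle i (-1)) =
        σ (nullSingle i 1) c • A (nullSingle i (-1)) := fun c => by
      rw [hσ' _ (hM i hi), (hone i hi).2]
    have hinj := smul_left_injective Q (hA.map_ne_zero h0 (nullSingle_ne_zero hi (-1)))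
    apply hinj
    simp only
    rw [← hscale, mul_smul, mul_smul, ← hscale b]
    by_cases hb : b = 0
    · simp [hb, h0]
    by_cases hb1 : b = -1
    · rw [hb1, neg_one_smul, smul_neg, hneg, hneg, smul_neg, hscale]
    · rw [hσ' _ (by simp [hM i hi]), ← hpm i j hi hj hij b hb hb1]
  let N : Submodule Q (Coord d Q) :=
    { carrier := {x | ∀ c, A (c • x) = σ (nullSingle i 1) c • A x}
      add_mem' := by
        intro v w hv hw c
        rw [smul_add, hadd, hadd, smul_add, hv, hw]
      zero_mem' := by intro c; simp [h0]
      smul_mem' := by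
        intro b x hx c
        rw [smul_smul, hx, hx, smul_smul, hmul] }
  have hp : ∀ k ≠ 0, nullSingle k 1 ∈ N := fun k hk c => by
    rw [hσ' _ (hP k hk), (hone k hk).1]
  have hm : ∀ k ≠ 0, nullSingle k (-1) ∈ N := fun k hk c => by
    rw [hσ' _ (hM k hk), (hone k hk).2]
  have hN : N = ⊤ := by
    have he0 : (Pi.single 0 1 : Coord d Q) ∈ N := by
      convert N.smul_mem (2⁻¹ : Q) (N.add_mem (hp i hi) (hm i hi)) using 1
      simp only [nullSingle]
      module
    apply submodule_eq_top_of_single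
    intro k
    by_cases hk : k = 0
    · rwa [hk]
    · simpa [nullSingle] using N.sub_mem (hp k hk) he0
  exact ⟨_, (hσ _ (hP i hi)).1 (nullSingle_ne_zero hi 1), fun c x => (hN ▸ Submodule.mem_top : x ∈ N) c⟩

/-- The hyperplanes of simultaneity of the two coordinate systems share a direction. -/
theorem exists_simultaneous (hd : 3 ≤ d) :
    ∃ v : Coord d Q, v ≠ 0 ∧ v 0 = 0 ∧ A v 0 = 0 := by
  obtain ⟨σ, hσ, hs⟩ := hA.exists_semilinear h0 hd
  obtain ⟨i, j, hi, hj, hij⟩ := exists_two_spatial hd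
  by_cases ha : A (Pi.single i 1) 0 = 0
  · exact ⟨Pi.single i 1, by simp, by simp [hi.symm], ha⟩
  -- Surjectivity of `σ` lets the two image time components cancel.
  obtain ⟨c, hc⟩ := hσ (-(A (Pi.single j 1) 0) / A (Pi.single i 1) 0)
  refine ⟨c • Pi.single i 1 + Pi.single j 1, fun h => ?_, by simp [hi.symm, hj.symm], ?_⟩
  · simpa [hij.symm] using congrFun h j
  · rw [hA.map_add_of_map_zero h0 hd, hs, hc]
    simp only [Pi.add_apply, Pi.smul_apply, smul_eq_mul]
    field_simp
    ring

/-- If the spatial distance of simultaneous events is preserved, then a light-preserving bijection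
fixing the origin is a Lorentz transformation. -/
theorem isLorentz (hd : 3 ≤ d)
    (hsym : ∀ v : Coord d Q, v 0 = 0 → A v 0 = 0 → mink d Q (A v) (A v) = mink d Q v v) :
    ∃ f : Coord d Q →ₗ[Q] Coord d Q, ⇑f = A ∧ ∀ x, mink d Q (f x) (f x) = mink d Q x x := by
  have hadd := hA.map_add_of_map_zero h0 hd
  obtain ⟨σ, -, hs⟩ := hA.exists_semilinear h0 hd
  obtain ⟨v, hv, hv0, hAv0⟩ := hA.exists_simultaneous h0 hd
  have hvv : mink d Q v v ≠ 0 := fun h => time_ne_zero_of_null h hv hv0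
  have hAv := hA.map_ne_zero h0 hv
  have hsq : ∀ c, σ c * σ c = c * c := by
    intro c
    have := hsym (c • v) (by simp [hv0]) (by rw [hs]; simp [hAv0])
    rw [hs] at this
    simp only [map_smul, LinearMap.smul_apply, smul_eq_mul, hsym v hv0 hAv0, ← mul_assoc] at this
    exact mul_right_cancel₀ hvv this
  have hσone : σ 1 = 1 := by
    apply smul_left_injective Q hAv
    simp only [← hs, one_smul]
  have hσadd : ∀ c, σ (c + 1) = σ c + 1 := by
    intro c
    apply smul_left_injective Q hAv
    simp only
    rw [← hs, add_smul, hadd, hs, hs, hσone, add_smul]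
  have hid : ∀ c, σ c = c := by
    intro c
    -- Expanding `(σ c + 1)² = (c + 1)²` and subtracting `(σ c)² = c²` removes the sign ambiguity.
    have h1 := hsq (c + 1)
    rw [hσadd] at h1
    linarith [hsq c]
  let f : Coord d Q →ₗ[Q] Coord d Q :=
    { toFun := A
      map_add' := hadd
      map_smul' := fun c x => by rw [hs, hid, RingHom.id_apply] }
  refine ⟨f, rfl, ?_⟩
  -- The pulled-back form is a multiple of the Minkowski form; evaluation at `v` shows the factor is
  -- `1`.
  have hprop := eq_smul_mink_of_null (b := (mink d Q).compl₁₂ f f)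
    (fun x y => mink_comm _ _) (fun u hu => hA.map_null h0 hu)
  have happ := fun x => congrArg (fun b : LinearMap.BilinForm Q (Coord d Q) => b x x) hprop
  simp only [LinearMap.compl₁₂_apply, LinearMap.smul_apply, smul_eq_mul] at happ
  have hone := happ v
  rw [show f v = A v from rfl, hsym v hv0 hAv0] at hone
  have hone' := mul_right_cancel₀ hvv ((one_mul _).trans hone)
  intro x
  rw [happ x, ← hone', one_mul]

end IsLightBijection

/-! ### From the axioms to light bijections. -/

namespace Model

variable {B : Type*} [LinearOrder Q] [IsStrictOrderedRing Q] {M : Model d B Q}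

theorem photon_iff (hd : 3 ≤ d) (hPh : M.AxPh) (hSymD : M.AxSymD) {m : B} (hm : m ∈ M.IOb)
    (x y : Coord d Q) :
    (∃ p ∈ M.Ph, M.W m p x ∧ M.W m p y) ↔ mink d Q (x - y) (x - y) = 0 := by
  obtain ⟨c, -, hc⟩ := hPh m hm
  have hlight : mink d Q (lightPoint d Q) (lightPoint d Q) = 0 := by
    have : lightPoint d Q = nullSingle ⟨1, by omega⟩ 1 := by
      funext i
      by_cases h0 : i = 0
      · subst h0
        simp [lightPoint, nullSingle, Fin.ext_iff]
      · by_cases h1 : (i : ℕ) = 1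
        · have hi : i = ⟨1, by omega⟩ := Fin.ext h1
          simp [lightPoint, nullSingle, hi, Fin.ext_iff]
        · have h0' : (i : ℕ) ≠ 0 := fun h => h0 (Fin.ext (by simpa using h))
          simp [lightPoint, nullSingle, h0, h1, Fin.ext_iff]
          omega
    rw [this]
    exact nullSingle_null (by simp [Fin.ext_iff]) (by ring)
  have h1 := (hc 0 (lightPoint d Q)).1 (hSymD.2 m hm)
  have h2 := mink_sub_self (0 : Coord d Q) (lightPoint d Q)
  have ht : time (0 : Coord d Q) (lightPoint d Q) = -1 := by simp [time, lightPoint]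
  rw [zero_sub, map_neg, map_neg, LinearMap.neg_apply, neg_neg, hlight, h1, ht] at h2
  have hcc : c ^ 2 = 1 := by linear_combination h2
  rw [hc, mink_sub_self, hcc, one_mul, sub_eq_zero, eq_comm]

theorem ev_nonempty (hd : 3 ≤ d) (hPh : M.AxPh) (hSymD : M.AxSymD) {m : B} (hm : m ∈ M.IOb)
    (x : Coord d Q) : (M.ev m x).Nonempty := by
  obtain ⟨p, -, hp, -⟩ := (photon_iff hd hPh hSymD hm x x).2 (by simp)
  exact ⟨p, hp⟩

theorem mink_eq_zero_iff_of_ev_eq (hd : 3 ≤ d) (hPh : M.AxPh) (hSymD : M.AxSymD) {m k : B}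
    (hm : m ∈ M.IOb) (hk : k ∈ M.IOb) {x y x' y' : Coord d Q} (hx : M.ev m x = M.ev k x')
    (hy : M.ev m y = M.ev k y') :
    mink d Q (x' - y') (x' - y') = 0 ↔ mink d Q (x - y) (x - y) = 0 := by
  rw [← photon_iff hd hPh hSymD hm x y, ← photon_iff hd hPh hSymD hk x' y']
  have hx' : ∀ p, M.W m p x ↔ M.W k p x' := fun p => Set.ext_iff.1 hx p
  have hy' : ∀ p, M.W m p y ↔ M.W k p y' := fun p => Set.ext_iff.1 hy p
  exact exists_congr fun p => by rw [hx', hy']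

/-- Inertial observers see different events at different coordinate points. -/
theorem ev_injective (hd : 3 ≤ d) (hPh : M.AxPh) (hSymD : M.AxSymD) {m : B}
    (hm : m ∈ M.IOb) : Function.Injective (M.ev m) := by
  intro x y hxy
  -- Equal events have equal light cones, so `x - y` is null and orthogonal to every null vector.
  have key : ∀ w, mink d Q w w = 0 → mink d Q (x - y) w = 0 := by
    have h1 := fun z => mink_eq_zero_iff_of_ev_eq hd hPh hSymD hm hm hxy (rfl : M.ev m z = _)
    have h2 := (h1 y).1 (by simp)
    intro w hw
    have h3 := (h1 (x + w)).2 (by simp [hw])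
    rw [show y - (x + w) = -w - (x - y) by abel, mink_sub_sub, h2, mink_comm (-w)] at h3
    simp only [map_neg, LinearMap.neg_apply, hw] at h3
    rw [mink_comm]
    linarith
  obtain ⟨i, -, hi, -⟩ := exists_two_spatial hd
  by_contra hne
  have hxy0 := sub_ne_zero.2 hne
  have hu : mink d Q (x - y) (x - y) = 0 :=
    (mink_eq_zero_iff_of_ev_eq hd hPh hSymD hm hm hxy (rfl : M.ev m y = _)).1 (by simp)
  have hp := key _ (nullSingle_null hi (s := (1 : Q)) (by ring))
  have hq := key _ (nullSingle_null hi (s := (-1 : Q)) (by ring))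
  rw [mink_nullSingle hi] at hp hq
  exact time_ne_zero_of_null hu hxy0 (by linarith)

end Model

end

end SpecRel

theorem theorem3p1 {d : ℕ} [NeZero d] (hd : 3 ≤ d) {B Q : Type*}
    [Field Q] [LinearOrder Q] [IsStrictOrderedRing Q]
    (M : SpecRel.Model d B Q) (hPh : M.AxPh) (hEv : M.AxEv) (hSymD : M.AxSymD)
    (m k : B) (hm : m ∈ M.IOb) (hk : k ∈ M.IOb) :
    SpecRel.IsPoincareRel (M.worldview m k) := by
  open SpecRel SpecRel.Model in
  have hev : ∀ x, ∃ y, M.ev m x = M.ev k y := hEv m hm k hk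
  choose P hev using hev
  have hinj := ev_injective hd hPh hSymD hm
  have hinj' := ev_injective hd hPh hSymD hk
  have hP : IsLightBijection P :=
    { bijective := by
        refine ⟨fun x y h => hinj ?_, fun y => ?_⟩
        · rw [hev, hev, h]
        · obtain ⟨x, hx⟩ := hEv k hk m hm y
          exact ⟨x, hinj' (by rw [← hev, hx])⟩
      null_iff := fun x y => mink_eq_zero_iff_of_ev_eq hd hPh hSymD hm hk (hev x) (hev y) }
  -- Subtracting `P 0` fixes the origin; for simultaneous points the Minkowski square is `-space2`,
  -- which the symmetry axiom preserves.
  obtain ⟨f, hf, hmink⟩ := (hP.sub_const (P 0)).isLorentz (sub_self _) hd (by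
    intro v hv hAv
    have hAv' : P v 0 = P 0 0 := sub_eq_zero.1 hAv
    have h := hSymD.1 m hm k hk v 0 (P v) (P 0) hv hAv' (hev v) (hev 0)
    have h1 := mink_sub_self (P v) (P 0)
    have h2 := mink_sub_self v 0
    simp only [time, hAv', hv, sub_zero, Pi.zero_apply, sub_self] at h1 h2
    rw [h1, h2, h])
  have hPf : ∀ x, P x = f x + P 0 := fun x => by simp [hf]
  refine ⟨P, ⟨⟨f.toAffineMap + AffineMap.const Q _ (P 0), ?_⟩, hP.bijective, ?_⟩, fun x y => ?_⟩
  · funext x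
    simp [hPf x]
  · intro x y
    rw [← mink_sub_self, ← mink_sub_self, hPf x, hPf y, add_sub_add_right_eq_sub, ← map_sub, hmink]
  · constructor
    · rintro ⟨h, -⟩
      exact hinj' (by rw [← hev, h])
    · rintro rfl
      exact ⟨hev x, ev_nonempty hd hPh hSymD hm x⟩
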